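/- For an $m\times m$ complex matrix $M$ with no zero entry let $M^{(-)}$ be its Schur (entrywise) inverse, $(M^{(-)})_{ij}=1/M_{ij}$, and let $\circ$ be the entrywise product. The Nomura algebra $\mathcal N_M$ is the set of all $m\times m$ complex matrices for which every vector $Me_i\circ M^{(-)}e_j$ $(1\le i,j\le m)$ is an eigenvector. For $n\times n$ complex matrices $A,B$ let $X_A(M)=AM$ and $\Delta_B(M)=B\circ M$, as linear maps on the space of $n\times n$ matrices. The pair $(A,B)$ is a one-sided Jones pair if $X_A$ and $\Delta_B$ are invertible and $X_A\Delta_BX_A=\Delta_BX_A\Delta_B$; it is an invertible Jones pair if $(A,B)$ and $(A,B^T)$ are both one-sided Jones pairs, $A$ has no zero entry and $B$ is invertible. Let $\pi=(C_1,\dots,C_r)$ be a partition of $\{1,\dots,m\}$, with $m\times r$ characteristic matrix $S$ ($S_{ik}=1$ if $i\in C_k$, and $S_{ik}=0$ otherwise), and let $\mathcal B$ be a set of $m\times m$ matrices. The partition $\pi$ is equitable relative to $\mathcal B$ if for every $M\in\mathcal B$ there is an $r\times r$ matrix $B_M$ with $MS=SB_M$; then $\{B_M: M\in\mathcal B\}$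 is called the quotient of $\mathcal B$ with respect to $\pi$. **Theorem.** Let $(A,B)$ be an invertible Jones pair of $n\times n$ complex matrices with $A$ symmetric, let $d\in\mathbb C$ with $d^2=n$, write $B^{(-)T}=(B^{(-)})^T$, and put $$W=\begin{pmatrix}A^T&-A^T\\ B^{(-)T}&B^{(-)T}\end{pmatrix},\qquad V=\begin{pmatrix}dA&-dA&B^{(-)}&B^{(-)}\\-dA&dA&B^{(-)}&B^{(-)}\\ B^{(-)T}&B^{(-)T}&dA&-dA\\ B^{(-)T}&B^{(-)T}&-dA&dA\end{pmatrix}.$$ For $i=1,\dots,n,2n+1,\dots,3n$ let $C_i=\{i,n+i\}$, and let $\pi=(C_1,\dots,C_n,C_{2n+1},\dots,C_{3n})$, a partition of $\{1,\dots,4n\}$. Then $\pi$ is equitable relative to $\mathcal N_V$, and the quotient of $\mathcal N_V$ with respect to $\pi$ is $\mathcal N_W$. -/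

import Mathlib

open scoped Matrix

noncomputable section

namespace JonesPair

variable {ι κ : Type*}

/-- The Schur inverse `A⁽⁻⁾`, the entrywise inverse of `A`. -/
def schurInv (A : Matrix ι ι ℂ) : Matrix ι ι ℂ := A.map (·⁻¹)

/-- All entries are nonzero, i.e. `A` is invertible for the Schur product. -/
def SchurInvertible (A : Matrix ι ι ℂ) : Prop := ∀ i j, A i j ≠ 0

/-- The endomorphism `X_A : M ↦ A M`. -/
def opX [Fintype ι] (A : Matrix ι ι ℂ) : Module.End ℂ (Matrix ι ι ℂ) where
  toFun M := A * M
  map_add' M N := Matrix.mul_add A M N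
  map_smul' c M := Matrix.mul_smul A c M

/-- The endomorphism `Δ_A : M ↦ A ∘ M` (Schur product). -/
def opΔ (A : Matrix ι ι ℂ) : Module.End ℂ (Matrix ι ι ℂ) where
  toFun M := A ⊙ M
  map_add' M N := Matrix.hadamard_add A M N
  map_smul' c M := Matrix.hadamard_smul A M c

/-- `(A, B)` is a one-sided Jones pair: `X_A` and `Δ_B` are invertible and
`X_A Δ_B X_A = Δ_B X_A Δ_B`. -/
structure IsOneSidedJonesPair [Fintype ι] (A B : Matrix ι ι ℂ) : Prop where
  isUnit_opX : IsUnit (opX A)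
  isUnit_opΔ : IsUnit (opΔ B)
  braid : opX A * opΔ B * opX A = opΔ B * opX A * opΔ B

/-- `(A, B)` is an invertible Jones pair: `(A, B)` and `(A, Bᵀ)` are one-sided Jones pairs,
`A` is Schur invertible and `B` is invertible. -/
structure IsInvertibleJonesPair [Fintype ι] [DecidableEq ι] (A B : Matrix ι ι ℂ) : Prop where
  left : IsOneSidedJonesPair A B
  right : IsOneSidedJonesPair A Bᵀ
  schurInvertible : SchurInvertible A
  isUnit : IsUnit B

/-- The vector `A e_i ∘ A⁽⁻⁾ e_j`. -/
def nomuraVec (A : Matrix ι ι ℂ) (i j : ι) : ι → ℂ := fun k => A k i * schurInv A k j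

/-- The Nomura algebra `N_A`: the matrices for which every `A e_i ∘ A⁽⁻⁾ e_j` is
an eigenvector. -/
def nomura [Fintype ι] [DecidableEq ι] (A : Matrix ι ι ℂ) : Subalgebra ℂ (Matrix ι ι ℂ) where
  carrier := {M | ∀ i j, ∃ c : ℂ, M *ᵥ nomuraVec A i j = c • nomuraVec A i j}
  mul_mem' := by
    intro M N hM hN i j
    obtain ⟨a, ha⟩ := hM i j
    obtain ⟨b, hb⟩ := hN i j
    exact ⟨b * a, by rw [← Matrix.mulVec_mulVec, hb, Matrix.mulVec_smul, ha, smul_smul]⟩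
  add_mem' := by
    intro M N hM hN i j
    obtain ⟨a, ha⟩ := hM i j
    obtain ⟨b, hb⟩ := hN i j
    exact ⟨a + b, by rw [Matrix.add_mulVec, ha, hb, add_smul]⟩
  algebraMap_mem' := by
    intro r i j
    exact ⟨r, by rw [Algebra.algebraMap_eq_smul_one, Matrix.smul_mulVec, Matrix.one_mulVec]⟩

open Classical in
/-- The characteristic matrix of a family of cells: the `(i, k)` entry is `1` if `i ∈ C k`
and `0` otherwise. -/
def charMatrix (C : κ → Set ι) : Matrix ι κ ℂ := Matrix.of fun i k => if i ∈ C k then 1 else 0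

/-- The partition with cells `C` is equitable relative to the set `𝓑` of matrices: every
`M ∈ 𝓑` has some `Q` with `M S = S Q`, for `S` the characteristic matrix. -/
def IsEquitable [Fintype ι] [Fintype κ] (𝓑 : Set (Matrix ι ι ℂ)) (C : κ → Set ι) : Prop :=
  ∀ M ∈ 𝓑, ∃ Q : Matrix κ κ ℂ, M * charMatrix C = charMatrix C * Q

/-- The set of all quotients, with respect to the partition with cells `C`, of the
matrices in `𝓑`. -/
def quotient [Fintype ι] [Fintype κ] (𝓑 : Set (Matrix ι ι ℂ)) (C : κ → Set ι) :
    Set (Matrix κ κ ℂ) :=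
  {Q | ∃ M ∈ 𝓑, M * charMatrix C = charMatrix C * Q}

variable {n : ℕ}

/-- The `2n × 2n` matrix `W`, in `n × n` blocks. -/
def matW (A B : Matrix (Fin n) (Fin n) ℂ) : Matrix (Fin n ⊕ Fin n) (Fin n ⊕ Fin n) ℂ :=
  Matrix.fromBlocks Aᵀ (-Aᵀ) (schurInv B)ᵀ (schurInv B)ᵀ

/-- The `4n × 4n` matrix `V`. The four groups of indices `1..n`, `n+1..2n`, `2n+1..3n`,
`3n+1..4n` are `inl ∘ inl`, `inl ∘ inr`, `inr ∘ inl`, `inr ∘ inr`. -/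
def matV (d : ℂ) (A B : Matrix (Fin n) (Fin n) ℂ) :
    Matrix ((Fin n ⊕ Fin n) ⊕ (Fin n ⊕ Fin n)) ((Fin n ⊕ Fin n) ⊕ (Fin n ⊕ Fin n)) ℂ :=
  Matrix.fromBlocks
    (Matrix.fromBlocks (d • A) (-(d • A)) (-(d • A)) (d • A))
    (Matrix.fromBlocks (schurInv B) (schurInv B) (schurInv B) (schurInv B))
    (Matrix.fromBlocks (schurInv B)ᵀ (schurInv B)ᵀ (schurInv B)ᵀ (schurInv B)ᵀ)
    (Matrix.fromBlocks (d • A) (-(d • A)) (-(d • A)) (d • A))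

/-- The cells `{i, n+i}` for `i = 1, …, n` (indexed by `inl`) and `i = 2n+1, …, 3n`
(indexed by `inr`). -/
def pairCells (n : ℕ) : Fin n ⊕ Fin n → Set ((Fin n ⊕ Fin n) ⊕ (Fin n ⊕ Fin n))
  | Sum.inl i => {Sum.inl (Sum.inl i), Sum.inl (Sum.inr i)}
  | Sum.inr i => {Sum.inr (Sum.inl i), Sum.inr (Sum.inr i)}

/-- The pairs do form a partition: every index lies in exactly one cell. -/
theorem existsUnique_mem_pairCells (x : (Fin n ⊕ Fin n) ⊕ (Fin n ⊕ Fin n)) :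
    ∃! k, x ∈ pairCells n k := by
  rcases x with (i | i) | (i | i)
  · exact ⟨Sum.inl i, by simp [pairCells], by rintro (j | j) h <;> simp_all [pairCells]⟩
  · exact ⟨Sum.inl i, by simp [pairCells], by rintro (j | j) h <;> simp_all [pairCells]⟩
  · exact ⟨Sum.inr i, by simp [pairCells], by rintro (j | j) h <;> simp_all [pairCells]⟩
  · exact ⟨Sum.inr i, by simp [pairCells], by rintro (j | j) h <;> simp_all [pairCells]⟩

end JonesPair

end

/-!
Let `D` run over the diagonal matrices of the vectors `A e_j ∘ B e_k`. The braid relation says that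
`A e_i ∘ B e_j` is an eigenvector of `A` with eigenvalue `B_{ij}`, so the `A e_i ∘ A⁽⁻⁾ e_j` and the
`B e_i ∘ B⁽⁻⁾ e_k` are both eigenbases of `D⁻¹ A D`, with eigenvalues `B_{ik}` and `B_{ji}`. As `B`
has distinct columns and distinct rows, the Nomura algebras of `A` and `B` are both the commutant of
all `D⁻¹ A D`, and evaluating `tr (P D⁻¹ A D)` in the two bases relates the eigenvalue matrices of
a common element `P`. The same relation for `(A, Bᵀ)`, together with the fact that `A` and `B` are
type II matrices, shows that interchanging the two halves of the index set carries the Nomura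
algebra of `W = W(A, B)` into that of `W(A, Bᵀ)`.

A Nomura vector of `V` indexed by two elements of the same half is constant on the cells and lifts
a Nomura vector of `W(A, B)` or, after interchanging the halves, of `W(A, Bᵀ)`; one indexed by
elements of different halves sums to zero on every cell. Hence `S Q Sᵀ / 2` lies in the Nomura
algebra of `V` for every `Q` in that of `W`, while the lifts of the Nomura vectors of `W` span the
vectors constant on the cells, which makes the partition equitable.
-/

namespace JonesPair

open Matrix

section Diagonalization

variable {ι κ K : Type*} [Fintype ι] [DecidableEq ι]

theorem commute_iff_of_semiconjBy {M : Type*} [Monoid M] {u x x' y y' : M} (hu : IsUnit u)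
    (h : SemiconjBy u x y) (h' : SemiconjBy u x' y') : Commute y y' ↔ Commute x x' := by
  rw [Commute, SemiconjBy, ← hu.mul_left_inj, ← (h.mul_right h').eq, ← (h'.mul_right h).eq,
    hu.mul_right_inj]
  rfl

theorem semiconjBy_diagonal_iff [CommSemiring K] {U P : Matrix ι ι K} {t : ι → K} :
    SemiconjBy U (diagonal t) P ↔ ∀ i, P *ᵥ U.col i = t i • U.col i := by
  have hentry : ∀ x i, (U * diagonal t) x i = (P * U) x i ↔ (P *ᵥ U.col i) x = (t i • U.col i) x :=
    fun x i => by rw [mul_diagonal, mul_comm, eq_comm]; rfl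
  simp only [SemiconjBy, ← Matrix.ext_iff, hentry, funext_iff]
  exact forall_comm

theorem eq_diagonal_diag_of_commute_diagonal [CommRing K] [IsDomain K] {N : Matrix ι ι K}
    {G : Matrix κ ι K} (hG : Function.Injective G.col)
    (h : ∀ k, Commute N (diagonal (G k))) : N = diagonal N.diag := by
  ext r s
  by_cases hrs : r = s
  · simp [hrs]
  rw [diagonal_apply_ne _ hrs]
  by_contra hN
  refine hrs (hG (funext fun k => ?_))
  have hentry := congr_fun₂ (h k).eq r s
  rw [mul_diagonal, diagonal_mul, mul_comm] at hentry
  exact (mul_right_cancel₀ hN hentry).symm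

theorem exists_semiconjBy_diagonal_iff_forall_commute [CommRing K] [IsDomain K]
    {U P : Matrix ι ι K} {M : κ → Matrix ι ι K} {G : Matrix κ ι K} (hU : IsUnit U)
    (hG : Function.Injective G.col) (hM : ∀ k, SemiconjBy U (diagonal (G k)) (M k)) :
    (∃ t, SemiconjBy U (diagonal t) P) ↔ ∀ k, Commute P (M k) := by
  constructor
  · rintro ⟨t, ht⟩ k
    exact (commute_iff_of_semiconjBy hU ht (hM k)).2 (commute_diagonal _ _)
  · intro h
    have hN : SemiconjBy U (U⁻¹ * P * U) P := by
      rw [SemiconjBy, mul_assoc, mul_nonsing_inv_cancel_left _ _ ((isUnit_iff_isUnit_det U).1 hU)]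
    have hdiag := eq_diagonal_diag_of_commute_diagonal hG fun k =>
      (commute_iff_of_semiconjBy hU hN (hM k)).1 (h k)
    exact ⟨_, hdiag ▸ hN⟩

theorem sum_mul_mul_inv_apply_of_semiconjBy [CommRing K] {U M : Matrix ι ι K} {t : ι → K}
    (hU : IsUnit U) (hM : SemiconjBy U (diagonal t) M) (i j : ι) :
    ∑ r, U i r * t r * U⁻¹ r j = M i j := by
  rw [← mul_nonsing_inv_cancel_right _ M ((isUnit_iff_isUnit_det U).1 hU), ← hM.eq,
    Matrix.mul_apply]
  simp only [mul_diagonal]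

theorem trace_mul_eq_dotProduct [CommRing K] {U M N : Matrix ι ι K} {s t : ι → K} (hU : IsUnit U)
    (hM : SemiconjBy U (diagonal s) M) (hN : SemiconjBy U (diagonal t) N) :
    (M * N).trace = s ⬝ᵥ t := by
  obtain ⟨u, rfl⟩ := hU
  have hconj : (u : Matrix ι ι K) * diagonal (s * t) * (u⁻¹ : (Matrix ι ι K)ˣ) = M * N := by
    rw [Units.mul_inv_eq_iff_eq_mul, ← (hM.mul_right hN).eq, diagonal_mul_diagonal]
    rfl
  rw [← hconj, trace_units_conj, trace_diagonal]
  rfl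

/-- The conjugate `D⁻¹ M D` of `M` by the diagonal matrix `D` with diagonal `v`. The Nomura
algebras of a Jones pair are the commutant of such conjugates. The entrywise inverse of `v` stands
for `D⁻¹`, so `v` must have no zero entry. -/
def diagConj [Field K] (v : ι → K) (M : Matrix ι ι K) : Matrix ι ι K :=
  diagonal v⁻¹ * M * diagonal v

theorem diagConj_apply [Field K] (v : ι → K) (M : Matrix ι ι K) (i j : ι) :
    diagConj v M i j = (v i)⁻¹ * M i j * v j := by
  simp [diagConj, mul_diagonal, diagonal_mul]

theorem semiconjBy_diagConj_iff [Field K] {v : ι → K} (hv : ∀ i, v i ≠ 0) {U D M : Matrix ι ι K} :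
    SemiconjBy U D (diagConj v M) ↔ SemiconjBy (diagonal v * U) D M := by
  have hinv : diagonal v * diagonal v⁻¹ = 1 := by
    simp [diagonal_mul_diagonal, hv]
  have hunit : IsUnit (diagonal v) := .of_mul_eq_one _ hinv
  rw [SemiconjBy, SemiconjBy, ← hunit.mul_right_inj, diagConj]
  simp only [← mul_assoc, hinv, one_mul]

end Diagonalization

section EigenvalueMatrix

variable {ι : Type*} [Fintype ι] {A B X Θ : Matrix ι ι ℂ}

/-- `Θ` is the matrix of eigenvalues of `X` at the vectors `A e_i ∘ B e_j`, written
`Θ_{A,B}(X) = Θ` in the theory of Jones pairs. With `B = A⁽⁻⁾` these are the vectors that define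
the Nomura algebra of `A`. -/
def HasEigenvalueMatrix (A B X Θ : Matrix ι ι ℂ) : Prop :=
  ∀ i j, X *ᵥ (A.col i * B.col j) = Θ i j • (A.col i * B.col j)

theorem HasEigenvalueMatrix.symm (h : HasEigenvalueMatrix A B X Θ) :
    HasEigenvalueMatrix B A X Θᵀ := fun i j => by
  rw [mul_comm, h, transpose_apply]

variable [DecidableEq ι]

theorem HasEigenvalueMatrix.inv (h : HasEigenvalueMatrix A B X Θ) (hX : IsUnit X)
    (hΘ : SchurInvertible Θ) : HasEigenvalueMatrix A B X⁻¹ (schurInv Θ) := fun i j => by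
  rw [schurInv, map_apply, eq_inv_smul_iff₀ (hΘ i j), ← mulVec_smul, ← h, mulVec_mulVec,
    nonsing_inv_mul _ ((isUnit_iff_isUnit_det X).1 hX), one_mulVec]

theorem HasEigenvalueMatrix.semiconjBy (h : HasEigenvalueMatrix A B X Θ) (j : ι) :
    SemiconjBy (diagonal (B.col j) * A) (diagonal (Θ.col j)) X := by
  have hcol : ∀ i, (diagonal (B.col j) * A).col i = A.col i * B.col j := fun i => by
    ext x
    simp [diagonal_mul, mul_comm]
  exact semiconjBy_diagonal_iff.2 fun i => by rw [hcol, h, col_apply]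

theorem HasEigenvalueMatrix.semiconjBy_diagConj (h : HasEigenvalueMatrix A B X Θ)
    (hB : SchurInvertible B) (j : ι) :
    SemiconjBy A (diagonal (Θ.col j)) (diagConj (B.col j) X) :=
  (semiconjBy_diagConj_iff fun x => hB x j).2 (h.semiconjBy j)

/-- The matrix whose columns are the vectors `C e_i ∘ C⁽⁻⁾ e_j`, for fixed `j`. The Nomura algebra
of `C` consists of the matrices diagonalized by all of them. -/
noncomputable def nomuraFrame (C : Matrix ι ι ℂ) (j : ι) : Matrix ι ι ℂ :=
  diagonal ((schurInv C).col j) * C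

theorem nomuraFrame_col (C : Matrix ι ι ℂ) (i j : ι) :
    (nomuraFrame C j).col i = nomuraVec C i j := by
  ext x
  simp [nomuraFrame, nomuraVec, diagonal_mul, mul_comm]

theorem isUnit_nomuraFrame {C : Matrix ι ι ℂ} (hC : SchurInvertible C) (hCu : IsUnit C) (j : ι) :
    IsUnit (nomuraFrame C j) := by
  refine (isUnit_diagonal.2 (Pi.isUnit_iff.2 fun x => ?_)).mul hCu
  exact (inv_ne_zero (hC x j)).isUnit

theorem mem_nomura_iff_exists_semiconjBy {P C : Matrix ι ι ℂ} :
    P ∈ nomura C ↔ ∀ j, ∃ t, SemiconjBy (nomuraFrame C j) (diagonal t) P := by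
  simp only [semiconjBy_diagonal_iff, nomuraFrame_col]
  refine ⟨fun h j => Classical.skolem.1 fun i => h i j, fun h i j => ?_⟩
  obtain ⟨t, ht⟩ := h j
  exact ⟨t i, ht i⟩

theorem mem_nomura_iff_exists_hasEigenvalueMatrix {P C : Matrix ι ι ℂ} :
    P ∈ nomura C ↔ ∃ S, HasEigenvalueMatrix C (schurInv C) P S := by
  refine ⟨fun h => ?_, fun ⟨S, hS⟩ i j => ⟨S i j, hS i j⟩⟩
  choose S hS using h
  exact ⟨of S, hS⟩

theorem HasEigenvalueMatrix.semiconjBy_nomuraFrame (h : HasEigenvalueMatrix A B X Θ)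
    (hA : SchurInvertible A) (hB : SchurInvertible B) (j k : ι) :
    SemiconjBy (nomuraFrame A j) (diagonal (Θ.col k)) (diagConj (A.col j * B.col k) X) := by
  rw [semiconjBy_diagConj_iff (v := A.col j * B.col k) fun x => mul_ne_zero (hA x j) (hB x k)]
  convert h.semiconjBy k using 1
  ext x y
  simp only [nomuraFrame, schurInv, diagonal_mul, Pi.mul_apply, col_apply, map_apply]
  field_simp [hA x j]

theorem HasEigenvalueMatrix.mem_nomura_iff_forall_commute (h : HasEigenvalueMatrix A B X Θ)
    (hA : SchurInvertible A) (hB : SchurInvertible B) (hAu : IsUnit A) (hΘ : IsUnit Θ)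
    {P : Matrix ι ι ℂ} :
    P ∈ nomura A ↔ ∀ j k, Commute P (diagConj (A.col j * B.col k) X) := by
  rw [mem_nomura_iff_exists_semiconjBy]
  refine forall_congr' fun j => exists_semiconjBy_diagonal_iff_forall_commute (G := Θᵀ)
    (isUnit_nomuraFrame hA hAu j) ?_ fun k => h.semiconjBy_nomuraFrame hA hB j k
  exact (linearIndependent_cols_of_isUnit ((isUnit_transpose Θ).2 hΘ)).injective

theorem HasEigenvalueMatrix.nomura_eq (h : HasEigenvalueMatrix A B X Θ)
    (hA : SchurInvertible A) (hB : SchurInvertible B) (hAu : IsUnit A) (hBu : IsUnit B)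
    (hΘ : IsUnit Θ) : nomura A = nomura B := by
  ext P
  rw [h.mem_nomura_iff_forall_commute hA hB hAu hΘ,
    h.symm.mem_nomura_iff_forall_commute hB hA hBu ((isUnit_transpose Θ).2 hΘ), forall_comm]
  simp only [mul_comm]

/-- Both sides are computed from `tr (P D⁻¹ X D)`, where `D` is the diagonal matrix of
`A e_j ∘ B e_k`: the vectors `A e_i ∘ A⁽⁻⁾ e_j` and the vectors `B e_i ∘ B⁽⁻⁾ e_k` are two bases
of common eigenvectors of `P` and `D⁻¹ X D`. -/
theorem HasEigenvalueMatrix.transpose_mul_eq_mul (h : HasEigenvalueMatrix A B X Θ)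
    (hA : SchurInvertible A) (hB : SchurInvertible B) (hAu : IsUnit A) (hBu : IsUnit B)
    {P S T : Matrix ι ι ℂ} (hS : HasEigenvalueMatrix A (schurInv A) P S)
    (hT : HasEigenvalueMatrix B (schurInv B) P T) : Sᵀ * Θ = Θ * T := by
  ext j k
  have htraceA := trace_mul_eq_dotProduct (isUnit_nomuraFrame hA hAu j) (hS.semiconjBy j)
    (h.semiconjBy_nomuraFrame hA hB j k)
  have htraceB := trace_mul_eq_dotProduct (isUnit_nomuraFrame hB hBu k)
    (h.symm.semiconjBy_nomuraFrame hB hA k j) (hT.semiconjBy k)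
  rw [mul_comm (B.col k), trace_mul_comm] at htraceB
  exact htraceA.symm.trans htraceB

end EigenvalueMatrix

section TypeII

variable {ι : Type*} [Fintype ι] [DecidableEq ι] {C : Matrix ι ι ℂ}

/-- `C` is a type II matrix: `C` and the transpose of its Schur inverse are inverse to each other
up to the factor `|ι|`. Both members of an invertible Jones pair have this property. -/
def IsTypeII (C : Matrix ι ι ℂ) : Prop := C * (schurInv C)ᵀ = (Fintype.card ι : ℂ) • 1

theorem IsTypeII.schurInv_transpose (h : IsTypeII C) (hC : IsUnit C) :
    (schurInv C)ᵀ = (Fintype.card ι : ℂ) • C⁻¹ := by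
  rw [← hC.mul_right_inj, h, mul_smul_comm, mul_nonsing_inv _ ((isUnit_iff_isUnit_det C).1 hC)]

theorem IsTypeII.isUnit_schurInv_transpose (h : IsTypeII C) (hC : IsUnit C) :
    IsUnit (schurInv C)ᵀ := by
  cases isEmpty_or_nonempty ι
  · exact isUnit_of_subsingleton _
  · have hcard : (Fintype.card ι : ℂ) ≠ 0 := Nat.cast_ne_zero.2 Fintype.card_ne_zero
    rw [h.schurInv_transpose hC]
    exact (isUnit_smul_iff (Units.mk0 _ hcard) _).2 (isUnit_nonsing_inv_iff.2 hC)

theorem IsTypeII.sum_mul_mul_inv_apply_of_semiconjBy (h : IsTypeII C) (hC : IsUnit C) {t : ι → ℂ}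
    {M : Matrix ι ι ℂ} (hM : SemiconjBy C (diagonal t) M) (i j : ι) :
    ∑ r, C i r * t r * (C j r)⁻¹ = Fintype.card ι * M i j := by
  have hinv : ∀ r, (C j r)⁻¹ = Fintype.card ι * C⁻¹ r j := fun r =>
    congr_fun₂ (h.schurInv_transpose hC) r j
  simp only [hinv, ← JonesPair.sum_mul_mul_inv_apply_of_semiconjBy hC hM i j, Finset.mul_sum]
  exact Finset.sum_congr rfl fun r _ => by ring

/-- The rows and columns of `C ∘ (C⁻¹)ᵀ` sum to `1`, so if this matrix has rank one then all its
entries are `1 / |ι|`. -/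
theorem isTypeII_of_mul_inv_apply_eq_mul (hC : IsUnit C) {α β : ι → ℂ}
    (h : ∀ i j, C i j * C⁻¹ j i = α i * β j) : IsTypeII C := by
  have hdet := (isUnit_iff_isUnit_det C).1 hC
  have hrow : ∀ i, α i * ∑ j, β j = 1 := fun i => by
    rw [Finset.mul_sum, ← one_apply_eq i, ← mul_nonsing_inv C hdet, Matrix.mul_apply]
    simp only [h]
  have hcol : ∀ j, (∑ i, α i) * β j = 1 := fun j => by
    rw [Finset.sum_mul, ← one_apply_eq j, ← nonsing_inv_mul C hdet, Matrix.mul_apply]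
    simp only [← h, mul_comm]
  have hsum : (∑ i, α i) * ∑ j, β j = Fintype.card ι := by
    simp [Finset.sum_mul, hrow]
  have hentry : ∀ i j, (C i j)⁻¹ = Fintype.card ι * C⁻¹ j i := fun i j => by
    refine (eq_inv_of_mul_eq_one_right ?_).symm
    linear_combination (Fintype.card ι : ℂ) * h i j - α i * β j * hsum +
      (∑ i, α i) * β j * hrow i + hcol j
  have hinv : (schurInv C)ᵀ = (Fintype.card ι : ℂ) • C⁻¹ := by
    ext j i
    exact hentry i j
  rw [IsTypeII, hinv, mul_smul_comm, mul_nonsing_inv C hdet]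

end TypeII

section JonesPair

variable {ι : Type*} [Fintype ι] {A B : Matrix ι ι ℂ}

theorem IsOneSidedJonesPair.isUnit_left [DecidableEq ι] (h : IsOneSidedJonesPair A B) :
    IsUnit A := by
  obtain ⟨M, hM⟩ := ((Module.End.isUnit_iff _).1 h.isUnit_opX).2 1
  exact .of_mul_eq_one M hM

theorem IsOneSidedJonesPair.schurInvertible_right (h : IsOneSidedJonesPair A B) :
    SchurInvertible B := fun i j h0 => by
  obtain ⟨M, hM⟩ := ((Module.End.isUnit_iff _).1 h.isUnit_opΔ).2 (of fun _ _ => 1)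
  simpa [opΔ, h0] using congr_fun₂ hM i j

theorem IsOneSidedJonesPair.hasEigenvalueMatrix (h : IsOneSidedJonesPair A B) :
    HasEigenvalueMatrix A B A B := fun l j => by
  classical
  ext i
  have hentry := congr_fun₂ (LinearMap.congr_fun h.braid (Matrix.single l j 1)) i j
  simp only [Module.End.mul_apply, opX, opΔ, LinearMap.coe_mk, AddHom.coe_mk, hadamard_apply,
    Matrix.mul_apply, single_apply] at hentry
  simpa [mulVec, dotProduct, mul_comm, mul_left_comm, mul_assoc] using hentry

variable [DecidableEq ι]

theorem IsOneSidedJonesPair.isTypeII_right (h : IsOneSidedJonesPair A B) (hA : SchurInvertible A)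
    (hB : IsUnit B) : IsTypeII B := by
  have hdiag : ∀ k, B *ᵥ (fun r => B k r * B⁻¹ r k) = A k k • 1 := fun k => by
    ext j
    calc ∑ r, B j r * (B k r * B⁻¹ r k) = ∑ r, B k r * B j r * B⁻¹ r k :=
          Finset.sum_congr rfl fun r _ => by ring
      _ = diagConj (A.col j) A k k := sum_mul_mul_inv_apply_of_semiconjBy hB
          (h.hasEigenvalueMatrix.symm.semiconjBy_diagConj hA j) k k
      _ = (A k k • (1 : ι → ℂ)) j := by simp [diagConj_apply, inv_mul_eq_div, hA k j]
  refine isTypeII_of_mul_inv_apply_eq_mul hB (α := A.diag) (β := B⁻¹ *ᵥ 1) fun k r => ?_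
  have hsolve := congr_fun (congr_arg (B⁻¹ *ᵥ ·) (hdiag k)) r
  rwa [mulVec_mulVec, nonsing_inv_mul _ ((isUnit_iff_isUnit_det B).1 hB), one_mulVec,
    mulVec_smul] at hsolve

theorem IsOneSidedJonesPair.isTypeII_left (h : IsOneSidedJonesPair A B) (hA : SchurInvertible A)
    (hB : IsUnit B) : IsTypeII A := by
  have hBne := h.schurInvertible_right
  have hinv := h.hasEigenvalueMatrix.inv h.isUnit_left hBne
  refine isTypeII_of_mul_inv_apply_eq_mul h.isUnit_left (β := A.diag)
    (α := fun i => (Fintype.card ι : ℂ)⁻¹ * ∑ r, (B i r)⁻¹) fun i j => ?_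
  have : Nonempty ι := ⟨i⟩
  have hsum : ∑ r, (B i r)⁻¹ = Fintype.card ι * ((A j j)⁻¹ * A⁻¹ j i * A i j) := by
    simpa [schurInv, diagConj_apply, hBne j _] using
      (h.isTypeII_right hA hB).sum_mul_mul_inv_apply_of_semiconjBy hB
        (hinv.symm.semiconjBy_diagConj hA j) j i
  rw [hsum, inv_mul_cancel_left₀ (Nat.cast_ne_zero.2 Fintype.card_ne_zero), diag_apply]
  field_simp [hA j j]

theorem IsOneSidedJonesPair.mulVec_nomuraVec_transpose (h : IsOneSidedJonesPair A B)
    (hA : SchurInvertible A) (hB : IsUnit B) (i j : ι) :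
    B *ᵥ nomuraVec Bᵀ j i = (Fintype.card ι * A i j) • nomuraVec A i j := by
  ext k
  calc ∑ r, B k r * (B j r * (B i r)⁻¹) = ∑ r, B k r * B j r * (B i r)⁻¹ := by
        simp only [mul_assoc]
    _ = Fintype.card ι * diagConj (A.col j) A k i :=
        (h.isTypeII_right hA hB).sum_mul_mul_inv_apply_of_semiconjBy hB
          (h.hasEigenvalueMatrix.symm.semiconjBy_diagConj hA j) k i
    _ = Fintype.card ι * A i j * (A k i * (A k j)⁻¹) := by
        rw [diagConj_apply, col_apply, col_apply]
        ring

theorem IsOneSidedJonesPair.transpose_mulVec_nomuraVec_transpose (h : IsOneSidedJonesPair A B)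
    (hA : SchurInvertible A) (hB : IsUnit B) (i j : ι) :
    Bᵀ *ᵥ nomuraVec Aᵀ i j = (Fintype.card ι * A i j) • nomuraVec Bᵀ j i := by
  ext k
  calc ∑ r, B r k * (A i r * (A j r)⁻¹) = ∑ r, A i r * B r k * (A j r)⁻¹ :=
        Finset.sum_congr rfl fun r _ => by ring
    _ = Fintype.card ι * diagConj (B.col k) A i j :=
        (h.isTypeII_left hA hB).sum_mul_mul_inv_apply_of_semiconjBy h.isUnit_left
          (h.hasEigenvalueMatrix.semiconjBy_diagConj h.schurInvertible_right k) i j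
    _ = Fintype.card ι * A i j * (B j k * (B i k)⁻¹) := by
        rw [diagConj_apply, col_apply, col_apply]
        ring

theorem IsOneSidedJonesPair.mul_eq_mul_transpose (h : IsOneSidedJonesPair A B)
    (hA : SchurInvertible A) (hB : IsUnit B) {P S T : Matrix ι ι ℂ}
    (hS : HasEigenvalueMatrix A (schurInv A) P S) (hT : HasEigenvalueMatrix B (schurInv B) P T) :
    S * B = B * Tᵀ := by
  cases isEmpty_or_nonempty ι
  · exact Subsingleton.elim _ _
  have hcard : (Fintype.card ι : ℂ) ≠ 0 := Nat.cast_ne_zero.2 Fintype.card_ne_zero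
  have hdet := (isUnit_iff_isUnit_det B).1 hB
  have hBne := h.schurInvertible_right
  have hinv := h.hasEigenvalueMatrix.inv h.isUnit_left hBne
  have hdual := congr_arg transpose
    (hinv.transpose_mul_eq_mul hA hBne h.isUnit_left hB hS hT)
  rw [transpose_mul, transpose_mul, transpose_transpose,
    (h.isTypeII_right hA hB).schurInv_transpose hB, smul_mul_assoc, mul_smul_comm] at hdual
  have hBinv := smul_right_injective _ hcard hdual
  calc S * B = B * (B⁻¹ * S) * B := by rw [mul_nonsing_inv_cancel_left _ _ hdet]
    _ = B * (Tᵀ * B⁻¹) * B := by rw [hBinv]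
    _ = B * Tᵀ := by rw [mul_assoc, mul_assoc, nonsing_inv_mul _ hdet, mul_one]

theorem IsInvertibleJonesPair.transpose (h : IsInvertibleJonesPair A B) :
    IsInvertibleJonesPair A Bᵀ :=
  ⟨h.right, h.left, h.schurInvertible, (isUnit_transpose B).2 h.isUnit⟩

theorem IsInvertibleJonesPair.nomura_eq (h : IsInvertibleJonesPair A B) : nomura A = nomura B :=
  h.left.hasEigenvalueMatrix.nomura_eq h.schurInvertible h.left.schurInvertible_right
    h.left.isUnit_left h.isUnit h.isUnit

theorem IsInvertibleJonesPair.exists_hasEigenvalueMatrix_swap (h : IsInvertibleJonesPair A B)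
    {P P' S : Matrix ι ι ℂ} (hP : HasEigenvalueMatrix A (schurInv A) P S)
    (hP' : HasEigenvalueMatrix Bᵀ (schurInv Bᵀ) P' Sᵀ) :
    ∃ T, HasEigenvalueMatrix A (schurInv A) P' T ∧ HasEigenvalueMatrix B (schurInv B) P Tᵀ := by
  obtain ⟨T, hT⟩ : ∃ T, HasEigenvalueMatrix A (schurInv A) P' T := by
    rw [← mem_nomura_iff_exists_hasEigenvalueMatrix, h.transpose.nomura_eq]
    exact mem_nomura_iff_exists_hasEigenvalueMatrix.2 ⟨_, hP'⟩
  obtain ⟨T', hT'⟩ : ∃ T', HasEigenvalueMatrix B (schurInv B) P T' := by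
    rw [← mem_nomura_iff_exists_hasEigenvalueMatrix, ← h.nomura_eq]
    exact mem_nomura_iff_exists_hasEigenvalueMatrix.2 ⟨_, hP⟩
  have hdual : Tᵀ * Bᵀ = Bᵀ * Sᵀ := h.right.hasEigenvalueMatrix.transpose_mul_eq_mul
    h.schurInvertible h.right.schurInvertible_right h.right.isUnit_left h.transpose.isUnit hT hP'
  rw [← transpose_mul, ← transpose_mul, transpose_inj,
    h.left.mul_eq_mul_transpose h.schurInvertible h.isUnit hP hT', h.isUnit.mul_right_inj] at hdual
  exact ⟨T, hT, by rwa [hdual, transpose_transpose]⟩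

end JonesPair

section MatW

theorem exists_fromBlocks_mulVec_elim_eq_smul_iff {ι K : Type*} [Fintype ι] [Field K]
    [CharZero K] {P R R' P' : Matrix ι ι K} {x y : ι → K} :
    ((∃ c : K, fromBlocks P R R' P' *ᵥ Sum.elim x y = c • Sum.elim x y) ∧
      ∃ c : K, fromBlocks P R R' P' *ᵥ Sum.elim (-x) y = c • Sum.elim (-x) y) ↔
    (∃ a : K, P *ᵥ x = a • x ∧ P' *ᵥ y = a • y) ∧ ∃ b : K, R *ᵥ y = b • x ∧ R' *ᵥ x = b • y := by
  have hsmul : ∀ (c : K) (u v : ι → K), c • Sum.elim u v = Sum.elim (c • u) (c • v) :=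
    fun c u v => by ext (i | i) <;> rfl
  simp only [fromBlocks_mulVec, Sum.elim_comp_inl, Sum.elim_comp_inr, hsmul, Sum.elim_eq_iff,
    mulVec_neg, smul_neg]
  constructor
  · rintro ⟨⟨c, hx, hy⟩, c', hx', hy'⟩
    refine ⟨⟨(c + c') / 2, ?_, ?_⟩, (c - c') / 2, ?_, ?_⟩
    · linear_combination (norm := module) (2⁻¹ : K) • (hx - hx')
    · linear_combination (norm := module) (2⁻¹ : K) • (hy + hy')
    · linear_combination (norm := module) (2⁻¹ : K) • (hx + hx')
    · linear_combination (norm := module) (2⁻¹ : K) • (hy - hy')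
  · rintro ⟨⟨a, hP, hP'⟩, b, hR, hR'⟩
    refine ⟨⟨a + b, ?_, ?_⟩, a - b, ?_, ?_⟩ <;>
      simp only [hP, hP', hR, hR'] <;> module

theorem mulVec_eq_div_smul {ι K : Type*} [Fintype ι] [Field K] {R B : Matrix ι ι K}
    {v w x : ι → K} {s t : K} (hs : s ≠ 0) (hv : B *ᵥ w = s • v) (h : (R * B) *ᵥ w = t • x) :
    R *ᵥ v = (t / s) • x := by
  rw [div_eq_inv_mul, mul_smul, eq_inv_smul_iff₀ hs, ← mulVec_smul, ← hv, mulVec_mulVec, h]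

variable {ι : Type*} [Fintype ι] [DecidableEq ι]

theorem IsInvertibleJonesPair.mulVec_nomuraVec {A B : Matrix ι ι ℂ}
    (h : IsInvertibleJonesPair A B) (hA : A.IsSymm) (i j : ι) :
    B *ᵥ nomuraVec A i j = (Fintype.card ι * A i j) • nomuraVec B j i := by
  simpa only [hA.eq, transpose_transpose] using
    h.right.transpose_mulVec_nomuraVec_transpose h.schurInvertible h.transpose.isUnit i j

theorem IsInvertibleJonesPair.transpose_mulVec_nomuraVec {A B : Matrix ι ι ℂ}
    (h : IsInvertibleJonesPair A B) (i j : ι) :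
    Bᵀ *ᵥ nomuraVec B j i = (Fintype.card ι * A i j) • nomuraVec A i j := by
  simpa only [transpose_transpose] using
    h.right.mulVec_nomuraVec_transpose h.schurInvertible h.transpose.isUnit i j

/-- Composing with `Bᵀ` and `B` turns the pair `R`, `R'` into a pair with common eigenvalues on
`A e_i ∘ A⁽⁻⁾ e_j` and `Bᵀ e_j ∘ Bᵀ⁽⁻⁾ e_i`, to which the swap of eigenvalue matrices applies. -/
theorem IsInvertibleJonesPair.exists_mulVec_nomuraVec_swap {A B R R' : Matrix ι ι ℂ}
    (h : IsInvertibleJonesPair A B) (hA : A.IsSymm)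
    (hR : ∀ i j, ∃ t : ℂ, R *ᵥ nomuraVec Bᵀ j i = t • nomuraVec A i j ∧
      R' *ᵥ nomuraVec A i j = t • nomuraVec Bᵀ j i) (i j : ι) :
    ∃ t : ℂ, R' *ᵥ nomuraVec B j i = t • nomuraVec A i j ∧
      R *ᵥ nomuraVec A i j = t • nomuraVec B j i := by
  choose t hR hR' using hR
  let S : Matrix ι ι ℂ := of fun i j => Fintype.card ι * A i j * t i j
  have hRB : HasEigenvalueMatrix A (schurInv A) (R * Bᵀ) S := fun i j => by
    change (R * Bᵀ) *ᵥ nomuraVec A i j = (Fintype.card ι * A i j * t i j) • nomuraVec A i j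
    rw [← mulVec_mulVec, h.transpose.mulVec_nomuraVec hA, mulVec_smul, hR, smul_smul]
  have hRB' : HasEigenvalueMatrix Bᵀ (schurInv Bᵀ) (R' * B) Sᵀ := fun j i => by
    change (R' * B) *ᵥ nomuraVec Bᵀ j i = (Fintype.card ι * A i j * t i j) • nomuraVec Bᵀ j i
    rw [← mulVec_mulVec, h.left.mulVec_nomuraVec_transpose h.schurInvertible h.isUnit,
      mulVec_smul, hR', smul_smul]
  obtain ⟨T, hT, hT'⟩ := h.exists_hasEigenvalueMatrix_swap hRB hRB'
  have : Nonempty ι := ⟨i⟩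
  have hscale : Fintype.card ι * A i j ≠ 0 :=
    mul_ne_zero (Nat.cast_ne_zero.2 Fintype.card_ne_zero) (h.schurInvertible i j)
  exact ⟨T i j / (Fintype.card ι * A i j),
    mulVec_eq_div_smul hscale (h.mulVec_nomuraVec hA i j) (hT i j),
    mulVec_eq_div_smul hscale (h.transpose_mulVec_nomuraVec i j) (hT' j i)⟩

theorem isUnit_fromBlocks_neg {K : Type*} [Field K] [CharZero K] {X Y : Matrix ι ι K}
    (hX : IsUnit X) (hY : IsUnit Y) : IsUnit (fromBlocks X (-X) Y Y) := by
  have hsigns : IsUnit (fromBlocks 1 (-1) 1 1 : Matrix (ι ⊕ ι) (ι ⊕ ι) K) := by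
    refine .of_mul_eq_one ((2⁻¹ : K) • fromBlocks 1 1 (-1) 1) ?_
    have hhalves : (2⁻¹ : K) • (1 : Matrix ι ι K) + (2⁻¹ : K) • 1 = 1 := by module
    simp [fromBlocks_multiply, ← fromBlocks_one, fromBlocks_smul, hhalves]
  have hdiag : IsUnit (fromBlocks X 0 0 Y) := isUnit_fromBlocks_zero₂₁.2 ⟨hX, hY⟩
  simpa [fromBlocks_multiply] using hdiag.mul hsigns

variable {n : ℕ} {A B : Matrix (Fin n) (Fin n) ℂ}

theorem forall_nomuraVec_matW_iff (hA : A.IsSymm) {p : (Fin n ⊕ Fin n → ℂ) → Prop} :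
    (∀ a b, p (nomuraVec (matW A B) a b)) ↔
      ∀ i j, p (Sum.elim (nomuraVec A i j) (nomuraVec Bᵀ j i)) ∧
        p (Sum.elim (-nomuraVec A i j) (nomuraVec Bᵀ j i)) := by
  have hll : ∀ i j, nomuraVec (matW A B) (.inl i) (.inl j) =
      Sum.elim (nomuraVec A i j) (nomuraVec Bᵀ j i) := fun i j => by
    ext (x | x) <;> simp [nomuraVec, matW, schurInv, hA.apply, mul_comm]
  have hlr : ∀ i j, nomuraVec (matW A B) (.inl i) (.inr j) =
      Sum.elim (-nomuraVec A i j) (nomuraVec Bᵀ j i) := fun i j => by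
    ext (x | x) <;> simp [nomuraVec, matW, schurInv, hA.apply, mul_comm, inv_neg]
  have hrl : ∀ i j, nomuraVec (matW A B) (.inr i) (.inl j) =
      Sum.elim (-nomuraVec A i j) (nomuraVec Bᵀ j i) := fun i j => by
    ext (x | x) <;> simp [nomuraVec, matW, schurInv, hA.apply, mul_comm]
  have hrr : ∀ i j, nomuraVec (matW A B) (.inr i) (.inr j) =
      Sum.elim (nomuraVec A i j) (nomuraVec Bᵀ j i) := fun i j => by
    ext (x | x) <;> simp [nomuraVec, matW, schurInv, hA.apply, mul_comm, inv_neg]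
  simp only [Sum.forall, hll, hlr, hrl, hrr]
  exact ⟨fun h i j => ⟨(h.1 i).1 j, (h.1 i).2 j⟩,
    fun h => ⟨fun i => ⟨fun j => (h i j).1, fun j => (h i j).2⟩,
      fun i => ⟨fun j => (h i j).2, fun j => (h i j).1⟩⟩⟩

theorem fromBlocks_mem_nomura_matW_iff (hA : A.IsSymm) {P R R' P' : Matrix (Fin n) (Fin n) ℂ} :
    fromBlocks P R R' P' ∈ nomura (matW A B) ↔
      (∃ S, HasEigenvalueMatrix A (schurInv A) P S ∧
        HasEigenvalueMatrix Bᵀ (schurInv Bᵀ) P' Sᵀ) ∧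
      ∀ i j, ∃ t : ℂ, R *ᵥ nomuraVec Bᵀ j i = t • nomuraVec A i j ∧
        R' *ᵥ nomuraVec A i j = t • nomuraVec Bᵀ j i := by
  refine (forall_nomuraVec_matW_iff hA
    (p := fun v => ∃ c : ℂ, fromBlocks P R R' P' *ᵥ v = c • v)).trans ?_
  simp only [exists_fromBlocks_mulVec_elim_eq_smul_iff, forall_and]
  refine and_congr_left' ⟨fun h => ?_, fun ⟨S, hS, hS'⟩ i j => ⟨S i j, hS i j, hS' j i⟩⟩
  choose S hS using h
  exact ⟨S, fun i j => (hS i j).1, fun i j => (hS j i).2⟩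

theorem IsInvertibleJonesPair.submatrix_swap_mem_nomura_matW (h : IsInvertibleJonesPair A B)
    (hA : A.IsSymm) {Q : Matrix (Fin n ⊕ Fin n) (Fin n ⊕ Fin n) ℂ} (hQ : Q ∈ nomura (matW A B)) :
    Q.submatrix Sum.swap Sum.swap ∈ nomura (matW A Bᵀ) := by
  obtain ⟨P, R, R', P', rfl⟩ : ∃ P R R' P', Q = fromBlocks P R R' P' :=
    ⟨_, _, _, _, (fromBlocks_toBlocks Q).symm⟩
  rw [fromBlocks_submatrix_sum_swap_sum_swap, fromBlocks_mem_nomura_matW_iff hA]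
  obtain ⟨⟨S, hP, hP'⟩, hoff⟩ := (fromBlocks_mem_nomura_matW_iff hA).1 hQ
  exact ⟨h.exists_hasEigenvalueMatrix_swap hP hP', h.exists_mulVec_nomuraVec_swap hA hoff⟩

theorem schurInvertible_matW (hA : SchurInvertible A) (hB : SchurInvertible B) :
    SchurInvertible (matW A B) := by
  rintro (i | i) (j | j) <;> simp [matW, schurInv, hA j i, hB j i]

theorem IsOneSidedJonesPair.isUnit_matW (h : IsOneSidedJonesPair A B) (hA : SchurInvertible A)
    (hB : IsUnit B) : IsUnit (matW A B) :=
  isUnit_fromBlocks_neg ((isUnit_transpose A).2 h.isUnit_left)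
    ((h.isTypeII_right hA hB).isUnit_schurInv_transpose hB)

end MatW

section Quotient

variable {ι κ : Type*} [Fintype ι] [Fintype κ] [DecidableEq κ]

theorem exists_mul_eq_mul_of_mulVec_col {K : Type*} [CommRing K] {M : Matrix ι ι K}
    {S : Matrix ι κ K} {U : Matrix κ κ K} (hU : IsUnit U)
    (h : ∀ a, ∃ c : K, M *ᵥ (S *ᵥ U.col a) = c • (S *ᵥ U.col a)) : ∃ Q, M * S = S * Q := by
  choose c hc using h
  have hMSU : M * S * U = S * U * diagonal c := by
    ext x a
    rw [Matrix.mul_assoc, mul_diagonal, mul_comm]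
    exact congr_fun (hc a) x
  exact ⟨U * diagonal c * U⁻¹, calc
    M * S = M * S * U * U⁻¹ := by
      rw [mul_nonsing_inv_cancel_right _ _ ((isUnit_iff_isUnit_det U).1 hU)]
    _ = S * (U * diagonal c * U⁻¹) := by simp only [hMSU, Matrix.mul_assoc]⟩

variable {S : Matrix ι κ ℂ} {L : Matrix κ ι ℂ} {V : Matrix ι ι ℂ}
  {Q W : Matrix κ κ ℂ}

theorem mul_mul_mem_nomura [DecidableEq ι] (hLS : L * S = 1)
    (h : ∀ i j, L *ᵥ nomuraVec V i j = 0 ∨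
      ∃ w, nomuraVec V i j = S *ᵥ w ∧ ∃ c : ℂ, Q *ᵥ w = c • w) :
    S * Q * L ∈ nomura V := by
  intro i j
  obtain hzero | ⟨w, hw, c, hc⟩ := h i j
  · exact ⟨0, by rw [← mulVec_mulVec, hzero, mulVec_zero, zero_smul]⟩
  · refine ⟨c, ?_⟩
    rw [hw, mulVec_mulVec, Matrix.mul_assoc, hLS, Matrix.mul_one, ← mulVec_mulVec, hc, mulVec_smul]

theorem mem_nomura_of_mul_eq_mul (hLS : L * S = 1) {M : Matrix ι ι ℂ} (hMQ : M * S = S * Q)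
    (h : ∀ a b, ∃ c : ℂ, M *ᵥ (S *ᵥ nomuraVec W a b) = c • (S *ᵥ nomuraVec W a b)) :
    Q ∈ nomura W := by
  intro a b
  obtain ⟨c, hc⟩ := h a b
  refine ⟨c, ?_⟩
  have hL := congr_arg (L *ᵥ ·) hc
  simpa [hMQ, ← mulVec_smul, mulVec_mulVec, ← Matrix.mul_assoc, hLS] using hL

end Quotient

section MatV

variable {n : ℕ} {d : ℂ} {A B : Matrix (Fin n) (Fin n) ℂ}

theorem charMatrix_pairCells :
    charMatrix (pairCells n) = fromBlocks (fromRows 1 1) 0 0 (fromRows 1 1) := by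
  ext ((i | i) | (i | i)) (k | k) <;> simp [charMatrix, pairCells, one_apply]

theorem charMatrix_pairCells_mulVec (v : Fin n ⊕ Fin n → ℂ) :
    charMatrix (pairCells n) *ᵥ v =
      Sum.elim (Sum.elim (v ∘ Sum.inl) (v ∘ Sum.inl)) (Sum.elim (v ∘ Sum.inr) (v ∘ Sum.inr)) := by
  simp [charMatrix_pairCells, fromBlocks_mulVec, fromRows_mulVec]

theorem half_smul_transpose_mul_charMatrix_pairCells :
    ((2⁻¹ : ℂ) • (charMatrix (pairCells n))ᵀ) * charMatrix (pairCells n) = 1 := by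
  have hhalves : (2⁻¹ : ℂ) • (1 : Matrix (Fin n) (Fin n) ℂ) + (2⁻¹ : ℂ) • 1 = 1 := by module
  simp [charMatrix_pairCells, fromBlocks_transpose, transpose_fromRows, fromBlocks_multiply,
    fromCols_mul_fromRows, fromBlocks_smul, hhalves]

theorem nomuraVec_matV_inl_inl (hd : d ≠ 0) (hA : A.IsSymm) (a b : Fin n ⊕ Fin n) :
    nomuraVec (matV d A B) (.inl a) (.inl b) =
      charMatrix (pairCells n) *ᵥ nomuraVec (matW A B) a b := by
  have hcancel : ∀ x y : ℂ, d * x * (y⁻¹ * d⁻¹) = x * y⁻¹ := fun x y => by field_simp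
  rw [charMatrix_pairCells_mulVec]
  ext ((i | i) | (i | i)) <;> rcases a with a | a <;> rcases b with b | b <;>
    simp [nomuraVec, matV, matW, schurInv, hA.apply, hcancel]

theorem nomuraVec_matV_inr_inr (hd : d ≠ 0) (hA : A.IsSymm) (a b : Fin n ⊕ Fin n) :
    nomuraVec (matV d A B) (.inr a) (.inr b) =
      charMatrix (pairCells n) *ᵥ (nomuraVec (matW A Bᵀ) a b ∘ Sum.swap) := by
  have hcancel : ∀ x y : ℂ, d * x * (y⁻¹ * d⁻¹) = x * y⁻¹ := fun x y => by field_simp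
  rw [charMatrix_pairCells_mulVec]
  ext ((i | i) | (i | i)) <;> rcases a with a | a <;> rcases b with b | b <;>
    simp [nomuraVec, matV, matW, schurInv, hA.apply, hcancel]

theorem transpose_charMatrix_mulVec_nomuraVec_matV_inl_inr (a b : Fin n ⊕ Fin n) :
    (charMatrix (pairCells n))ᵀ *ᵥ nomuraVec (matV d A B) (.inl a) (.inr b) = 0 := by
  ext (i | i) <;> rcases a with a | a <;> rcases b with b | b <;>
    simp [charMatrix_pairCells, fromBlocks_transpose, transpose_fromRows, fromBlocks_mulVec,
      fromCols_mulVec, nomuraVec, matV, schurInv, inv_neg]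

theorem transpose_charMatrix_mulVec_nomuraVec_matV_inr_inl (a b : Fin n ⊕ Fin n) :
    (charMatrix (pairCells n))ᵀ *ᵥ nomuraVec (matV d A B) (.inr a) (.inl b) = 0 := by
  ext (i | i) <;> rcases a with a | a <;> rcases b with b | b <;>
    simp [charMatrix_pairCells, fromBlocks_transpose, transpose_fromRows, fromBlocks_mulVec,
      fromCols_mulVec, nomuraVec, matV, schurInv, inv_neg]

theorem exists_mulVec_charMatrix_nomuraVec_matW (hd : d ≠ 0) (hA : A.IsSymm)
    {M : Matrix ((Fin n ⊕ Fin n) ⊕ (Fin n ⊕ Fin n)) ((Fin n ⊕ Fin n) ⊕ (Fin n ⊕ Fin n)) ℂ}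
    (hM : M ∈ nomura (matV d A B)) (a b : Fin n ⊕ Fin n) :
    ∃ c : ℂ, M *ᵥ (charMatrix (pairCells n) *ᵥ nomuraVec (matW A B) a b) =
      c • (charMatrix (pairCells n) *ᵥ nomuraVec (matW A B) a b) := by
  rw [← nomuraVec_matV_inl_inl hd hA]
  exact hM (.inl a) (.inl b)

theorem IsInvertibleJonesPair.isEquitable_nomura_matV (h : IsInvertibleJonesPair A B)
    (hd : d ≠ 0) (hA : A.IsSymm) : IsEquitable (nomura (matV d A B)) (pairCells n) := by
  intro M hM
  cases isEmpty_or_nonempty (Fin n ⊕ Fin n) with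
  | inl _ => exact ⟨0, Subsingleton.elim _ _⟩
  | inr hne =>
    obtain ⟨b⟩ := hne
    have hW := schurInvertible_matW h.schurInvertible h.left.schurInvertible_right
    have hWu := h.left.isUnit_matW h.schurInvertible h.isUnit
    refine exists_mul_eq_mul_of_mulVec_col (isUnit_nomuraFrame hW hWu b) fun a => ?_
    rw [nomuraFrame_col]
    exact exists_mulVec_charMatrix_nomuraVec_matW hd hA hM a b

theorem lift_mem_nomura_matV (hd : d ≠ 0) (hA : A.IsSymm)
    {Q : Matrix (Fin n ⊕ Fin n) (Fin n ⊕ Fin n) ℂ} (hQ : Q ∈ nomura (matW A B))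
    (hQswap : Q.submatrix Sum.swap Sum.swap ∈ nomura (matW A Bᵀ)) :
    charMatrix (pairCells n) * Q * ((2⁻¹ : ℂ) • (charMatrix (pairCells n))ᵀ) ∈
      nomura (matV d A B) := by
  refine mul_mul_mem_nomura half_smul_transpose_mul_charMatrix_pairCells ?_
  rintro (a | a) (b | b)
  · exact .inr ⟨_, nomuraVec_matV_inl_inl hd hA a b, hQ a b⟩
  · exact .inl (by rw [smul_mulVec, transpose_charMatrix_mulVec_nomuraVec_matV_inl_inr, smul_zero])
  · exact .inl (by rw [smul_mulVec, transpose_charMatrix_mulVec_nomuraVec_matV_inr_inl, smul_zero])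
  · obtain ⟨c, hc⟩ := hQswap a b
    refine .inr ⟨_, nomuraVec_matV_inr_inr hd hA a b, c, ?_⟩
    ext x
    have hsub := congr_fun (submatrix_mulVec_equiv Q (nomuraVec (matW A Bᵀ) a b) Sum.swap
      (Equiv.sumComm _ _)) x.swap
    simpa only [Function.comp_apply, Sum.swap_swap, Equiv.sumComm_symm, Equiv.sumComm_apply,
      Pi.smul_apply] using hsub.symm.trans (congr_fun hc x.swap)

theorem IsInvertibleJonesPair.quotient_nomura_matV (h : IsInvertibleJonesPair A B)
    (hd : d ≠ 0) (hA : A.IsSymm) :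
    quotient (nomura (matV d A B)) (pairCells n) = (nomura (matW A B) : Set _) := by
  have hLS := half_smul_transpose_mul_charMatrix_pairCells (n := n)
  ext Q
  constructor
  · rintro ⟨M, hM, hMQ⟩
    exact mem_nomura_of_mul_eq_mul hLS hMQ (exists_mulVec_charMatrix_nomuraVec_matW hd hA hM)
  · intro hQ
    refine ⟨_, lift_mem_nomura_matV hd hA hQ (h.submatrix_swap_mem_nomura_matW hA hQ), ?_⟩
    rw [Matrix.mul_assoc, hLS, Matrix.mul_one]

theorem exists_ne_zero_matV_eq (hd : d ^ 2 = n) (A B : Matrix (Fin n) (Fin n) ℂ) :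
    ∃ d' ≠ 0, matV d A B = matV d' A B := by
  by_cases h0 : d = 0
  · obtain rfl : n = 0 := by simpa [h0, eq_comm] using hd
    exact ⟨1, one_ne_zero, Subsingleton.elim _ _⟩
  · exact ⟨d, h0, rfl⟩

end MatV

end JonesPair

theorem mainTheorem5_general {n : ℕ} {d : ℂ} (hd : d ≠ 0) {A B : Matrix (Fin n) (Fin n) ℂ}
    (hAB : JonesPair.IsInvertibleJonesPair A B) (hA : A.IsSymm) :
    JonesPair.IsEquitable (JonesPair.nomura (JonesPair.matV d A B)) (JonesPair.pairCells n) ∧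
      JonesPair.quotient (JonesPair.nomura (JonesPair.matV d A B)) (JonesPair.pairCells n) =
        (JonesPair.nomura (JonesPair.matW A B) :
          Set (Matrix (Fin n ⊕ Fin n) (Fin n ⊕ Fin n) ℂ)) :=
  ⟨hAB.isEquitable_nomura_matV hd hA, hAB.quotient_nomura_matV hd hA⟩

theorem mainTheorem5 (n : ℕ) (d : ℂ) (hd : d ^ 2 = (n : ℂ))
    (A B : Matrix (Fin n) (Fin n) ℂ)
    (hAB : JonesPair.IsInvertibleJonesPair A B) (hA : A.IsSymm) :
    JonesPair.IsEquitable (JonesPair.nomura (JonesPair.matV d A B)) (JonesPair.pairCells n) ∧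
      JonesPair.quotient (JonesPair.nomura (JonesPair.matV d A B)) (JonesPair.pairCells n) =
        (JonesPair.nomura (JonesPair.matW A B) :
          Set (Matrix (Fin n ⊕ Fin n) (Fin n ⊕ Fin n) ℂ)) := by
  obtain ⟨d', hd', hV⟩ := JonesPair.exists_ne_zero_matV_eq hd A B
  exact hV ▸ mainTheorem5_general hd' hAB hA
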